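/- Let $p\ge 0$ and consider independent Gaussian linear models $y^i=X^i\beta^i+z^i$, $i=1,2,\dots$, where $X^i\in\mathbb R^{n_i\times p}$ is deterministic with rank $p$ (so $n_i\ge p$) and unit-norm columns, $\beta^i\in\mathbb R^p$ is an arbitrary signal, and the entries of all $z^i$ are jointly independent with $z^i_k\sim\mathcal N(0,\sigma_i^2)$ (unknown, possibly different variances). The number of models $m$ is a random variable with values in $\{0,1,2,\dots\}$, independent of $(z^i)_i$ (deterministic $m$ included). The hypotheses are $H_{0,j}:\beta^1_j=\dots=\beta^m_j=0$, $1\le j\le p$. Knockoff statistics of each model. Let $\widetilde X^i\in\mathbb R^{n_i\times p}$ be any knockoff design, i.e. $\widetilde X^{i\top}\widetilde X^i=X^{i\top}X^i$ and $X^{i\top}\widetilde X^i=X^{i\top}X^i-\operatorname{diag}(s^i)$ for some $s^i\in\mathbb R^p$ with nonnegative entries. A pilot estimator produces measurable statistics $(Z^i_j,\widetilde Z^i_j)_{j\le p}$ that depend on the data only through $A^\top A$, $A^\top y^i$ and $\|y^i\|_2^2$, where $A=[X^i,\widetilde X^i]$, in such a way that exchanging the $j$th original and knockoff columns for all $j$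 in any set exchanges the corresponding $Z^i_j$ and $\widetilde Z^i_j$. Put $\chi^i_j=\operatorname{sgn}(Z^i_j-\widetilde Z^i_j)$, and let $W^i_1,\dots,W^i_p\ge 0$ be any measurable functions of $(Z^i,\widetilde Z^i)$ that are invariant under exchanging $Z^i_j$ with $\widetilde Z^i_j$ for any set of indices $j$. Assume that there are almost surely no ties at nulls: $Z^i_j\ne\widetilde Z^i_j$ almost surely whenever $\beta^i_j=0$. Aggregation. For each possible value of $m$ let $\Gamma:\mathbb R_+^m\to\mathbb R_+$ be any measurable summary function (in particular, any measurable one that is non-decreasing in each coordinate), and put $$\chi_j=\frac m2+\frac12\sum_{i=1}^m\chi^i_j,\qquad W_j=\Gamma(W^1_j,\dots,W^m_j),\qquad P_j=\frac1{2^m}\sum_{0\le i\le m,\ i\ge\chi_j}\binom mi .$$ Weighted knockoff+ rule. Let $q\in(0,1)$ and let $\Omega:[0,1]\to[0,1]$ be any confidence function, that is, a non-increasing function with $\lim_{x\to0+}\Omega(x)=\Omega(0)=1$ and $\lim_{x\to1-}\Omega(x)=\Omega(1)=0$; let $U$ be uniform on $[0,1]$. Let $\rho$ be a permutation with $W_{\rho(1)}\ge\dots\ge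 W_{\rho(p)}$, where ties are broken by a measurable rule that depends only on $m$ and $(W_1,\dots,W_p)$. Let $$\widehat k=\max\Big\{1\le k\le p:\ \frac{1+\sum_{j=1}^k(1-\Omega(P_{\rho(j)}))}{\sum_{j=1}^k\Omega(P_{\rho(j)})}\le\frac q{\mathbb E\,\Omega(U)}-q\Big\}$$ (a ratio with zero denominator counts as $+\infty$, and nothing is rejected if the set is empty), and set $\omega_{\rho(j)}=\Omega(P_{\rho(j)})$ for $j\le\widehat k$ and $\omega_{\rho(j)}=0$ otherwise. Then the weighted false discovery rate is at most $q$: $$\mathrm{FDR}_w=\mathbb E\left[\frac{\sum_{j:\,H_{0,j}\text{ true}}\omega_j}{\sum_{j=1}^p\omega_j}\right]\le q,$$ where the fraction is $0$ if $\sum_j\omega_j=0$. -/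

import Mathlib

open MeasureTheory ProbabilityTheory Filter Topology Matrix
open scoped NNReal

noncomputable section

namespace Knockoff

/-- The design has full column rank (so at least as many rows as columns) and unit columns. -/
structure IsDesign {n p : ℕ} (X : Matrix (Fin n) (Fin p) ℝ) : Prop where
  full_rank : X.rank = p
  normalized : ∀ j, ∑ k, X k j ^ 2 = 1

/-- `Xk` is a knockoff copy of the design `X`. -/
def IsKnockoff {n p : ℕ} (X Xk : Matrix (Fin n) (Fin p) ℝ) : Prop :=
  ∃ s : Fin p → ℝ, (∀ j, 0 ≤ s j) ∧ Xkᵀ * Xk = Xᵀ * X ∧ Xᵀ * Xk = Xᵀ * X - Matrix.diagonal s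

/-- The action on column indices of the augmented design `[X, Xk]` that exchanges the `j`-th
original column with the `j`-th knockoff column for every `j ∈ S`. -/
def swapCols {p : ℕ} (S : Finset (Fin p)) : Fin p ⊕ Fin p → Fin p ⊕ Fin p
  | Sum.inl j => if j ∈ S then Sum.inr j else Sum.inl j
  | Sum.inr j => if j ∈ S then Sum.inl j else Sum.inr j

/-- A pilot estimator together with the ordering statistics built from it.
`pilot G u t` is evaluated at the Gram matrix `G = AᵀA` of the augmented design `A = [X, Xk]`, at
`u = Aᵀy` and at `t = ‖y‖²`; it returns the statistics `Z_j` (at `inl j`) and `Z̃_j` (at `inr j`).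
Exchanging originals with knockoffs exchanges the corresponding values of the pilot, and the
ordering statistics `W` are symmetric in each pair `(Z_j, Z̃_j)`. -/
structure Statistic (p : ℕ) where
  pilot : Matrix (Fin p ⊕ Fin p) (Fin p ⊕ Fin p) ℝ → (Fin p ⊕ Fin p → ℝ) → ℝ →
    (Fin p ⊕ Fin p → ℝ)
  ordering : (Fin p ⊕ Fin p → ℝ) → (Fin p → ℝ≥0)
  measurable_pilot : ∀ G, Measurable fun x : (Fin p ⊕ Fin p → ℝ) × ℝ => pilot G x.1 x.2
  measurable_ordering : Measurable ordering
  pilot_swap : ∀ (S : Finset (Fin p)) (G : Matrix (Fin p ⊕ Fin p) (Fin p ⊕ Fin p) ℝ)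
    (u : Fin p ⊕ Fin p → ℝ) (t : ℝ),
    pilot (G.submatrix (swapCols S) (swapCols S)) (u ∘ swapCols S) t = pilot G u t ∘ swapCols S
  ordering_swap : ∀ (S : Finset (Fin p)) (Z : Fin p ⊕ Fin p → ℝ),
    ordering (Z ∘ swapCols S) = ordering Z

namespace Statistic

variable {n p : ℕ}

/-- The pilot statistics `(Z, Z̃)` computed from one data set. -/
def Z (T : Statistic p) (X Xk : Matrix (Fin n) (Fin p) ℝ) (y : Fin n → ℝ) : Fin p ⊕ Fin p → ℝ :=
  T.pilot ((fromCols X Xk)ᵀ * fromCols X Xk) ((fromCols X Xk)ᵀ *ᵥ y) (y ⬝ᵥ y)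

/-- The ordering statistics `W_1, …, W_p` of one data set. -/
def W (T : Statistic p) (X Xk : Matrix (Fin n) (Fin p) ℝ) (y : Fin n → ℝ) : Fin p → ℝ≥0 :=
  T.ordering (T.Z X Xk y)

/-- The one-bit p-values `χ_j = sgn (Z_j - Z̃_j)` of one data set. -/
def chi (T : Statistic p) (X Xk : Matrix (Fin n) (Fin p) ℝ) (y : Fin n → ℝ) (j : Fin p) : ℝ :=
  Real.sign (T.Z X Xk y (Sum.inl j) - T.Z X Xk y (Sum.inr j))

end Statistic

/-- The aggregated `χ`-statistics. -/
def aggChi {m p : ℕ} (chi : Fin m → Fin p → ℝ) (j : Fin p) : ℝ :=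
  (m : ℝ) / 2 + 1 / 2 * ∑ i, chi i j

/-- The aggregated ordering statistics for the summary function `Γ`. -/
def aggW {m p : ℕ} (Γ : (Fin m → ℝ≥0) → ℝ≥0) (W : Fin m → Fin p → ℝ≥0) (j : Fin p) : ℝ≥0 :=
  Γ fun i => W i j

/-- The binomial p-value `2^{-m} ∑_{i = c}^m (m choose i)`. -/
def pValue (m : ℕ) (c : ℝ) : ℝ :=
  (∑ i ∈ (Finset.range (m + 1)).filter (fun i : ℕ => c ≤ (i : ℝ)), (m.choose i : ℝ)) / 2 ^ m

/-- Confidence functions `[0, 1] → [0, 1]`; values outside `[0, 1]` are never used. -/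
structure IsConfidence (conf : ℝ → ℝ) : Prop where
  mapsTo : Set.MapsTo conf (Set.Icc 0 1) (Set.Icc 0 1)
  antitone : AntitoneOn conf (Set.Icc 0 1)
  zero : conf 0 = 1
  one : conf 1 = 0
  tendsto_zero : Tendsto conf (𝓝[>] 0) (𝓝 1)
  tendsto_one : Tendsto conf (𝓝[<] 1) (𝓝 0)

/-- `E conf(U)` for `U` uniformly distributed on `[0, 1]`. -/
def meanConf (conf : ℝ → ℝ) : ℝ := ∫ u in Set.Icc (0 : ℝ) 1, conf u

/-- The stopping condition at `k`; a ratio with zero denominator counts as `+∞`.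
The hypothesis of rank `r + 1` is `ρ r`. -/
def Passes {p : ℕ} (q : ℝ) (conf : ℝ → ℝ) (P : Fin p → ℝ) (ρ : Equiv.Perm (Fin p)) (k : ℕ) :
    Prop :=
  0 < ∑ r : Fin p with r.val < k, conf (P (ρ r)) ∧
    (1 + ∑ r : Fin p with r.val < k, (1 - conf (P (ρ r)))) /
      (∑ r : Fin p with r.val < k, conf (P (ρ r))) ≤ q / meanConf conf - q

open Classical in
/-- The largest `k` in `{1, …, p}` that passes, and `0` (no rejection) if there is none. -/
def kHat {p : ℕ} (q : ℝ) (conf : ℝ → ℝ) (P : Fin p → ℝ) (ρ : Equiv.Perm (Fin p)) : ℕ :=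
  ((Finset.Icc 1 p).filter (Passes q conf P ρ)).sup id

/-- The rejection weights: `conf (P j)` for the first `kHat` hypotheses in the order `ρ`,
and `0` for the others. -/
def weights {p : ℕ} (q : ℝ) (conf : ℝ → ℝ) (P : Fin p → ℝ) (ρ : Equiv.Perm (Fin p)) (j : Fin p) :
    ℝ :=
  if (ρ.symm j).val < kHat q conf P ρ then conf (P j) else 0

open Classical in
/-- The weighted false discovery proportion of the weights `w`. -/
def wFDP {p : ℕ} (null : Fin p → Prop) (w : Fin p → ℝ) : ℝ :=
  if 0 < ∑ j, w j then (∑ j with null j, w j) / ∑ j, w j else 0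

/-- The true nulls among the hypotheses `H_{0,j} : β^1_j = ⋯ = β^m_j = 0` for `m` models. -/
def IsNull {p : ℕ} (β : ℕ → Fin p → ℝ) (m : ℕ) (j : Fin p) : Prop := ∀ i < m, β i j = 0

/-- The weights returned by the whole procedure on the first `m` data sets. The rule `ρ` orders
the hypotheses according to the aggregated ordering statistics. -/
def procedure {p : ℕ} {n : ℕ → ℕ} (m : ℕ) (X Xk : ∀ i, Matrix (Fin (n i)) (Fin p) ℝ)
    (T : ℕ → Statistic p) (Γ : (Fin m → ℝ≥0) → ℝ≥0)
    (ρ : (Fin p → ℝ≥0) → Equiv.Perm (Fin p)) (q : ℝ) (conf : ℝ → ℝ) (y : ∀ i, Fin (n i) → ℝ) :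
    Fin p → ℝ :=
  weights q conf
    (fun j => pValue m (aggChi (fun i : Fin m => (T i).chi (X i) (Xk i) (y i)) j))
    (ρ (aggW Γ fun i : Fin m => (T i).W (X i) (Xk i) (y i)))

/-- A rule that turns ordering statistics into a ranking: it sorts them in non-increasing order,
and breaks ties in a measurable way that depends on these statistics only. -/
structure IsRankingRule {p : ℕ} (ρ : (Fin p → ℝ≥0) → Equiv.Perm (Fin p)) : Prop where
  sorts : ∀ w, Antitone (w ∘ ρ w)
  measurable : ∀ σ, MeasurableSet {w | ρ w = σ}

end Knockoff

end

/-!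
The proof rests on two symmetries and a backward supermartingale.

*Sign symmetry.* The knockoff conditions say that `X_j - X̃_j` is orthogonal to all columns of
`[X, X̃]` other than the `j`-th pair, so the reflection along it exchanges `X_j` with `X̃_j` and fixes
the rest. Isotropic Gaussian noise is invariant under this reflection, and the mean `X β` is fixed if
`β_j = 0`. Hence any pattern of column exchanges at nulls of the separate models is realised by a
transformation of the noise that preserves its law (`IsKnockoff.exists_measurePreserving`,
`exists_flip`). It flips the corresponding signs `χ^i_j` and changes neither the ordering statistics
nor the other signs. So the false discovery rate does not change if, at almost every data point, the
false discovery proportion is replaced by its average over all sign patterns of the true nulls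
(`integral_noiseFDP_le`); no conditional distributions are needed. The random number of models is
integrated out at the end by independence.

*The average over sign patterns.* The ranking and the non-null p-values are now frozen, and the nulls
have independent weights with the law of `conf P` for a binomial p-value `P`. The mean weight is at
most `a = E conf(U)`, as a lower Riemann sum of the integral (`IsConfidence.sum_conf_pValue_le`). Let
`V_k` be the total weight and `D_k` the total missing weight `∑ (1 - ω)` of the nulls among the first
`k` hypotheses. The stopping condition bounds the proportion by `q (1 - a) / a` times the stopped value
of `V_k / (1 + D_k)` (`wFDP_weights_le`), so it remains to bound the mean of the latter by
`a / (1 - a)`.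

*Exchangeability.* The event that the procedure stops at or before `k` is symmetric in the nulls up to
the next position. Averaging over exchanges of these nulls and using that `t ↦ 1 / (D + t)` lies below
its chord on `[0, 1]` shows that `V_k / (1 + D_k)` is a supermartingale as `k` decreases
(`sum_remove_one_le`, `sum_nullRatio_step_le`), so the stopped mean is at most the mean at the starting
point `k = p` (`sum_nullRatio_lastPass_le`). At `k = p`, dropping the missing weight of the `i`-th null
from the denominator makes its weight independent of it; replacing weights by missing weights costs the
factor `a / (1 - a)`, and the shares of the missing weights add up to at most one
(`sum_nullRatio_all_le`).
-/

namespace Knockoff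

/-! ### Optional stopping for exchangeable weights -/

/-- The weights with value `f (b r)` at the null positions `r ∈ J` and frozen values `c r`
elsewhere. -/
noncomputable def patternWeights {p : ℕ} {B : Type*} (J : Finset (Fin p)) (f : B → ℝ)
    (c : Fin p → ℝ) (b : Fin p → B) (r : Fin p) : ℝ :=
  if r ∈ J then f (b r) else c r

/-- The null positions among the first `k`. -/
def nullsBelow {p : ℕ} (J : Finset (Fin p)) (k : ℕ) : Finset (Fin p) := J.filter (·.val < k)

/-- The process `V / (1 + D)`, where `V` is the total weight and `D` the total missing weight of
the nulls among the first `k` positions. -/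
noncomputable def nullRatio {p : ℕ} (J : Finset (Fin p)) (x : Fin p → ℝ) (k : ℕ) : ℝ :=
  (∑ r ∈ nullsBelow J k, x r) / (1 + ∑ r ∈ nullsBelow J k, (1 - x r))

/-- The stopping condition in terms of the sorted weights, for a threshold `C`. -/
def PassesAt {p : ℕ} (C : ℝ) (x : Fin p → ℝ) (k : ℕ) : Prop :=
  0 < ∑ r : Fin p with r.val < k, x r ∧
    (1 + ∑ r : Fin p with r.val < k, (1 - x r)) / (∑ r : Fin p with r.val < k, x r) ≤ C

open Classical in
/-- The largest passing index, or `0`. -/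
noncomputable def lastPass {p : ℕ} (C : ℝ) (x : Fin p → ℝ) : ℕ :=
  ((Finset.Icc 1 p).filter (PassesAt C x)).sup id

/-- Removing one term at random does not increase the expected ratio. The reason is the convexity of
`t ↦ 1 / (D + t)`, which lies below its chord on `[0, 1]`. -/
lemma sum_remove_one_le {ι : Type*} (I : Finset ι) (x : ι → ℝ)
    (h0 : ∀ i ∈ I, 0 ≤ x i) (h1 : ∀ i ∈ I, x i ≤ 1) :
    ∑ i ∈ I, (∑ j ∈ I, x j - x i) / (1 + (∑ j ∈ I, (1 - x j) - (1 - x i))) ≤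
      I.card * ((∑ j ∈ I, x j) / (1 + ∑ j ∈ I, (1 - x j))) := by
  set N := ∑ j ∈ I, x j with hN
  set D := ∑ j ∈ I, (1 - x j) with hD
  have hK : (I.card : ℝ) = N + D := by
    rw [hN, hD, ← Finset.sum_add_distrib]; simp
  have hN0 : 0 ≤ N := Finset.sum_nonneg h0
  have hD0 : 0 ≤ D := Finset.sum_nonneg fun i hi => sub_nonneg.2 (h1 i hi)
  rcases hD0.eq_or_lt with hz | hpos
  -- for `D = 0` the chord is not defined, but then all weights equal `1`
  · have hx : ∀ i ∈ I, x i = 1 := by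
      intro i hi
      have := (Finset.sum_eq_zero_iff_of_nonneg
        (fun i hi => sub_nonneg.2 (h1 i hi))).1 (hD.symm.trans hz.symm) i hi
      linarith
    have : ∀ i ∈ I, (N - x i) / (1 + (D - (1 - x i))) = N - 1 := by
      intro i hi
      rw [hx i hi, ← hz]; simp
    rw [Finset.sum_congr rfl this, ← hz]
    simp only [Finset.sum_const, nsmul_eq_mul, add_zero, div_one]
    exact mul_le_mul_of_nonneg_left (by linarith) (Nat.cast_nonneg _)
  · have key : ∀ i ∈ I, (N - x i) / (1 + (D - (1 - x i))) ≤
        (N + D) * ((1 - x i) / D + x i / (D + 1)) - 1 := by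
      intro i hi
      have a := h0 i hi
      have b := h1 i hi
      have e1 : (N - x i) / (1 + (D - (1 - x i))) = (N + D) * (1 / (D + x i)) - 1 := by
        have : D + x i ≠ 0 := by linarith
        rw [show 1 + (D - (1 - x i)) = D + x i by ring]
        field_simp; ring
      have e2 : 1 / (D + x i) ≤ (1 - x i) / D + x i / (D + 1) := by
        rw [div_add_div _ _ hpos.ne' (by linarith), div_le_div_iff₀ (by linarith) (by positivity)]
        nlinarith [mul_nonneg a (sub_nonneg.2 b)]
      rw [e1]
      exact sub_le_sub_right (mul_le_mul_of_nonneg_left e2 (by linarith)) _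
    refine (Finset.sum_le_sum key).trans (le_of_eq ?_)
    rw [Finset.sum_sub_distrib, ← Finset.mul_sum, Finset.sum_add_distrib, ← Finset.sum_div,
      ← Finset.sum_div, ← hN, ← hD]
    simp only [Finset.sum_const, nsmul_eq_mul, mul_one]
    rw [hK]
    have : D + 1 ≠ 0 := by linarith
    have : 1 + D ≠ 0 := by linarith
    field_simp
    ring

lemma patternWeights_mem {p : ℕ} {B : Type*} {J : Finset (Fin p)} {f : B → ℝ} {c : Fin p → ℝ}
    (hf : ∀ t, f t ∈ Set.Icc (0 : ℝ) 1) (hc : ∀ r, c r ∈ Set.Icc (0 : ℝ) 1) (b : Fin p → B)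
    (r : Fin p) : patternWeights J f c b r ∈ Set.Icc (0 : ℝ) 1 := by
  unfold patternWeights; split_ifs
  exacts [hf _, hc _]

lemma patternWeights_swap {p : ℕ} {B : Type*} {J : Finset (Fin p)} (f : B → ℝ) (c : Fin p → ℝ)
    (b : Fin p → B) {i k : Fin p} (hi : i ∈ J) (hk : k ∈ J) :
    patternWeights J f c (b ∘ Equiv.swap i k) = patternWeights J f c b ∘ Equiv.swap i k := by
  funext r
  have : Equiv.swap i k r ∈ J ↔ r ∈ J := by
    rcases eq_or_ne r i with rfl | h1
    · simp [hi, hk]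
    rcases eq_or_ne r k with rfl | h2
    · simp [hi, hk]
    rw [Equiv.swap_apply_of_ne_of_ne h1 h2]
  by_cases hr : r ∈ J
  · simp [patternWeights, this, hr]
  · have h1 : r ≠ i := by rintro rfl; exact hr hi
    have h2 : r ≠ k := by rintro rfl; exact hr hk
    simp [patternWeights, hr, Equiv.swap_apply_of_ne_of_ne h1 h2]

lemma sum_below_swap {p : ℕ} (x : Fin p → ℝ) {i k : Fin p} {l : ℕ} (hi : i.val < l)
    (hk : k.val < l) :
    ∑ r : Fin p with r.val < l, x (Equiv.swap i k r) = ∑ r : Fin p with r.val < l, x r := by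
  refine Finset.sum_equiv (Equiv.swap i k) (fun r => ?_) fun _ _ => rfl
  simp only [Finset.mem_filter, Finset.mem_univ, true_and]
  rcases eq_or_ne r i with rfl | h1
  · simp [hi, hk]
  rcases eq_or_ne r k with rfl | h2
  · simp [hi, hk]
  rw [Equiv.swap_apply_of_ne_of_ne h1 h2]

/-- The stopping condition at `l` is a symmetric function of the first `l` weights. -/
lemma passesAt_swap {p : ℕ} (C : ℝ) (x : Fin p → ℝ) {i k : Fin p} {l : ℕ} (hi : i.val < l)
    (hk : k.val < l) : PassesAt C (x ∘ Equiv.swap i k) l ↔ PassesAt C x l := by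
  have h1 := sum_below_swap x hi hk
  have h2 := sum_below_swap (fun r => 1 - x r) hi hk
  simp only [PassesAt, Function.comp_apply, h1, h2]

lemma lastPass_le_iff {p : ℕ} (C : ℝ) (x : Fin p → ℝ) (k : ℕ) :
    lastPass C x ≤ k ↔ ∀ l, k < l → l ≤ p → ¬ PassesAt C x l := by
  classical
  simp only [lastPass, Finset.sup_le_iff, Finset.mem_filter, Finset.mem_Icc, id]
  constructor
  · intro h l hl hlp hP
    have := h l ⟨⟨by omega, hlp⟩, hP⟩
    omega
  · rintro h l ⟨⟨_, hlp⟩, hP⟩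
    by_contra hl
    exact h l (by omega) hlp hP

lemma lastPass_le {p : ℕ} (C : ℝ) (x : Fin p → ℝ) : lastPass C x ≤ p :=
  (lastPass_le_iff C x p).2 fun l h1 h2 => by omega

/-- If something passes, then the last passing index does. -/
lemma passesAt_lastPass {p : ℕ} (C : ℝ) (x : Fin p → ℝ) (h : 0 < lastPass C x) :
    PassesAt C x (lastPass C x) := by
  classical
  have hne : ((Finset.Icc 1 p).filter (PassesAt C x)).Nonempty := by
    by_contra hn
    rw [Finset.not_nonempty_iff_eq_empty] at hn
    simp [lastPass, hn] at h
  obtain ⟨l, hl, hl'⟩ := Finset.exists_mem_eq_sup _ hne id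
  rw [lastPass, hl']
  exact (Finset.mem_filter.1 hl).2

lemma lastPass_swap {p : ℕ} (C : ℝ) (x : Fin p → ℝ) {i k : Fin p} {l : ℕ} (hi : i.val ≤ l)
    (hk : k.val ≤ l) : lastPass C (x ∘ Equiv.swap i k) ≤ l ↔ lastPass C x ≤ l := by
  simp only [lastPass_le_iff]
  refine forall_congr' fun a => forall_congr' fun ha => ?_
  rw [passesAt_swap C x (by omega) (by omega)]

lemma nullsBelow_succ_of_notMem {p : ℕ} {J : Finset (Fin p)} {k : Fin p} (hk : k ∉ J) :
    nullsBelow J (k + 1) = nullsBelow J k := by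
  ext r
  simp only [nullsBelow, Finset.mem_filter, and_congr_right_iff]
  intro hr
  have : r ≠ k := by rintro rfl; exact hk hr
  have : r.val ≠ k.val := fun h => this (Fin.ext h)
  omega

lemma nullsBelow_eq_erase {p : ℕ} (J : Finset (Fin p)) (k : Fin p) :
    nullsBelow J k = (nullsBelow J (k + 1)).erase k := by
  ext r
  simp only [nullsBelow, Finset.mem_filter, Finset.mem_erase, ne_eq, Fin.ext_iff]
  grind

/-- After exchanging the null positions `i` and `k`, the sum over the nulls before `k` is the sum
over those up to `k` with `x i` removed. -/
lemma sum_nullsBelow_swap {p : ℕ} {J : Finset (Fin p)} (x : Fin p → ℝ) {i k : Fin p}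
    (hi : i ∈ nullsBelow J (k + 1)) (hk : k ∈ J) :
    ∑ r ∈ nullsBelow J k, x (Equiv.swap i k r) = ∑ r ∈ nullsBelow J (k + 1), x r - x i := by
  have hk' : k ∈ nullsBelow J (k + 1) := by simp [nullsBelow, hk]
  rw [← Finset.sum_erase_eq_sub hi, nullsBelow_eq_erase]
  refine Finset.sum_equiv (Equiv.swap i k) (fun r => ?_) fun _ _ => rfl
  rcases eq_or_ne r i with rfl | h1
  · rcases eq_or_ne r k with rfl | h2
    · simp
    · simp [hi, hk', h2, h2.symm]
  rcases eq_or_ne r k with rfl | h2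
  · simp
  rw [Equiv.swap_apply_of_ne_of_ne h1 h2]
  simp [h1, h2]

variable {p : ℕ} {B : Type*} [Fintype B]

/-- The backward supermartingale inequality: on an event that is symmetric in the nulls up to
position `k`, one step backwards does not increase the expected ratio. -/
lemma sum_nullRatio_step_le {J : Finset (Fin p)} {f : B → ℝ} {c : Fin p → ℝ}
    (hf : ∀ t, f t ∈ Set.Icc (0 : ℝ) 1) (hc : ∀ r, c r ∈ Set.Icc (0 : ℝ) 1) (k : Fin p)
    (E : (Fin p → B) → Prop) [DecidablePred E]
    (hE : ∀ i ∈ nullsBelow J (k + 1), k ∈ J → ∀ b, E (b ∘ Equiv.swap i k) ↔ E b) :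
    ∑ b with E b, nullRatio J (patternWeights J f c b) k ≤
      ∑ b with E b, nullRatio J (patternWeights J f c b) (k + 1) := by
  by_cases hk : k ∈ J
  swap
  · simp [nullRatio, nullsBelow_succ_of_notMem hk]
  set I := nullsBelow J (k + 1) with hI
  have hkI : k ∈ I := by simp [hI, nullsBelow, hk]
  have hcard : (0 : ℝ) < I.card := by exact_mod_cast Finset.card_pos.2 ⟨k, hkI⟩
  -- reindexing by the exchange of `i` and `k` does not change the sum over the event
  have hsw : ∀ i ∈ I, ∑ b with E b, nullRatio J (patternWeights J f c b) k =
      ∑ b with E b, nullRatio J (patternWeights J f c (b ∘ Equiv.swap i k)) k := by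
    intro i hi
    symm
    refine Finset.sum_equiv ((Equiv.swap i k).arrowCongr (Equiv.refl B)) (fun b => ?_)
      fun b _ => ?_
    · have : (Equiv.swap i k).arrowCongr (Equiv.refl B) b = b ∘ Equiv.swap i k := by
        ext; simp [Equiv.arrowCongr]
      simp [this, hE i hi hk b]
    · have : (Equiv.swap i k).arrowCongr (Equiv.refl B) b = b ∘ Equiv.swap i k := by
        ext; simp [Equiv.arrowCongr]
      rw [this]
  refine le_of_mul_le_mul_left ?_ hcard
  calc (I.card : ℝ) * ∑ b with E b, nullRatio J (patternWeights J f c b) k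
      = ∑ i ∈ I, ∑ b with E b, nullRatio J (patternWeights J f c (b ∘ Equiv.swap i k)) k := by
        rw [← Finset.sum_congr rfl hsw]; simp
    _ = ∑ b with E b, ∑ i ∈ I, nullRatio J (patternWeights J f c (b ∘ Equiv.swap i k)) k :=
        Finset.sum_comm
    _ ≤ ∑ b with E b, I.card * nullRatio J (patternWeights J f c b) (k + 1) := by
        refine Finset.sum_le_sum fun b _ => ?_
        have hx := patternWeights_mem (J := J) hf hc b
        refine le_trans (le_of_eq ?_) (sum_remove_one_le I (patternWeights J f c b)
          (fun i _ => (hx i).1) fun i _ => (hx i).2)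
        refine Finset.sum_congr rfl fun i hi => ?_
        have hiJ : i ∈ J := (Finset.mem_filter.1 hi).1
        rw [patternWeights_swap f c b hiJ hk, nullRatio]
        simp only [Function.comp_apply]
        rw [sum_nullsBelow_swap _ hi hk,
          sum_nullsBelow_swap (fun r => 1 - patternWeights J f c b r) hi hk]
    _ = _ := by rw [Finset.mul_sum]

/-- Optional stopping for the ratio of the nulls at the last passing index. -/
lemma sum_nullRatio_lastPass_le {J : Finset (Fin p)} {f : B → ℝ} {c : Fin p → ℝ}
    (hf : ∀ t, f t ∈ Set.Icc (0 : ℝ) 1) (hc : ∀ r, c r ∈ Set.Icc (0 : ℝ) 1) (C : ℝ) :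
    ∑ b : Fin p → B, nullRatio J (patternWeights J f c b) (lastPass C (patternWeights J f c b)) ≤
      ∑ b : Fin p → B, nullRatio J (patternWeights J f c b) p := by
  classical
  set x := patternWeights J f c
  -- the process stopped at `max (lastPass) k` interpolates between the two sides
  have main : ∀ k ≤ p, ∑ b : Fin p → B, nullRatio J (x b) (lastPass C (x b)) ≤
      ∑ b : Fin p → B, nullRatio J (x b) (max (lastPass C (x b)) k) := by
    intro k
    induction k with
    | zero => simp
    | succ k ih =>
      intro hk
      refine (ih (by omega)).trans ?_
      rw [← Finset.sum_filter_add_sum_filter_not Finset.univ (fun b => lastPass C (x b) ≤ k),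
        ← Finset.sum_filter_add_sum_filter_not Finset.univ (fun b => lastPass C (x b) ≤ k)
          (fun b => nullRatio J (x b) (max (lastPass C (x b)) (k + 1)))]
      refine add_le_add ?_ (le_of_eq ?_)
      · have := sum_nullRatio_step_le (J := J) hf hc ⟨k, hk⟩ (fun b => lastPass C (x b) ≤ k)
          (fun i hi hkJ b => by
            have hi' := Finset.mem_filter.1 hi
            rw [show x (b ∘ _) = _ from patternWeights_swap f c b hi'.1 hkJ]
            exact lastPass_swap C (x b) (Nat.lt_succ_iff.1 hi'.2) le_rfl)
        convert! this using 1
        · refine Finset.sum_congr rfl fun b hb => ?_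
          rw [max_eq_right (Finset.mem_filter.1 hb).2]
        · refine Finset.sum_congr rfl fun b hb => ?_
          rw [max_eq_right ((Finset.mem_filter.1 hb).2.trans (Nat.le_succ k))]
      · refine Finset.sum_congr rfl fun b hb => ?_
        have := (Finset.mem_filter.1 hb).2
        rw [max_eq_left (by omega), max_eq_left (by omega)]
  refine (main p le_rfl).trans (le_of_eq ?_)
  refine Finset.sum_congr rfl fun b _ => ?_
  rw [max_eq_right (lastPass_le _ _)]

/-- Resampling one coordinate preserves the uniform distribution on patterns. -/
lemma sum_sum_update (g : (Fin p → B) → ℝ) (i : Fin p) :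
    ∑ b : Fin p → B, ∑ t : B, g (Function.update b i t) =
      Fintype.card B * ∑ b : Fin p → B, g b := by
  -- exchanging the fresh value with the old one is an involution
  let e : (Fin p → B) × B ≃ (Fin p → B) × B :=
    { toFun := fun y => (Function.update y.1 i y.2, y.1 i)
      invFun := fun y => (Function.update y.1 i y.2, y.1 i)
      left_inv := fun y => by simp
      right_inv := fun y => by simp }
  have h1 := Fintype.sum_equiv e (fun y => g (Function.update y.1 i y.2)) (fun y => g y.1)
    fun y => rfl
  rw [Fintype.sum_prod_type, Fintype.sum_prod_type] at h1
  simpa [Finset.mul_sum] using h1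

lemma sum_mul_of_update_invariant [Nonempty B] (f : B → ℝ) (A : (Fin p → B) → ℝ) (i : Fin p)
    (hA : ∀ b t, A (Function.update b i t) = A b) :
    ∑ b : Fin p → B, f (b i) * A b = (∑ t, f t) / Fintype.card B * ∑ b : Fin p → B, A b := by
  have hB : (Fintype.card B : ℝ) ≠ 0 := by exact_mod_cast Fintype.card_ne_zero
  have := sum_sum_update (fun b => f (b i) * A b) i
  simp only [Function.update_self, hA, ← Finset.sum_mul] at this
  rw [← Finset.mul_sum] at this
  field_simp
  linarith

/-- With all nulls included, the expected ratio is at most the odds of the mean weight: the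
nulls are independent, so `x i` may be replaced by its mean given the others, and the shares
`(1 - x i) / ∑ (1 - x r)` add up to at most `1`. -/
lemma sum_nullRatio_all_le [Nonempty B] {J : Finset (Fin p)} {f : B → ℝ} {c : Fin p → ℝ}
    (hf : ∀ t, f t ∈ Set.Icc (0 : ℝ) 1) (hc : ∀ r, c r ∈ Set.Icc (0 : ℝ) 1) {a : ℝ}
    (ha0 : 0 ≤ a) (ha : a < 1) (hfa : ∑ t, f t ≤ Fintype.card B * a) :
    ∑ b : Fin p → B, nullRatio J (patternWeights J f c b) p ≤
      (Fintype.card (Fin p → B)) * (a / (1 - a)) := by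
  have hn : (0 : ℝ) < Fintype.card B := by exact_mod_cast Fintype.card_pos
  set x := patternWeights J f c with hxdef
  have hx : ∀ b r, x b r ∈ Set.Icc (0 : ℝ) 1 := patternWeights_mem hf hc
  have hxJ : ∀ b, ∀ i ∈ J, x b i = f (b i) := fun b i hi => by simp [hxdef, patternWeights, hi]
  have hall : nullsBelow J p = J := by
    ext r; simp [nullsBelow]
  -- `A i` does not depend on the `i`-th coordinate
  let A : Fin p → (Fin p → B) → ℝ := fun i b => (1 + ∑ r ∈ J.erase i, (1 - x b r))⁻¹
  have hS : ∀ i b, 0 ≤ ∑ r ∈ J.erase i, (1 - x b r) :=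
    fun i b => Finset.sum_nonneg fun r _ => sub_nonneg.2 (hx b r).2
  have hA0 : ∀ i b, 0 ≤ A i b := fun i b => inv_nonneg.2 (by linarith [hS i b])
  have hA : ∀ i b t, A i (Function.update b i t) = A i b := by
    intro i b t
    simp only [A]
    congr 2
    refine Finset.sum_congr rfl fun r hr => ?_
    rw [hxJ _ _ (Finset.mem_of_mem_erase hr), hxJ _ _ (Finset.mem_of_mem_erase hr),
      Function.update_of_ne (Finset.ne_of_mem_erase hr)]
  have hone : ∀ b, ∑ i ∈ J, (1 - x b i) * A i b ≤ 1 := by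
    intro b
    set D := ∑ r ∈ J, (1 - x b r) with hD
    have hle : ∀ i ∈ J, (1 - x b i) * A i b ≤ (1 - x b i) / D := by
      intro i hi
      have he : (1 - x b i) + ∑ r ∈ J.erase i, (1 - x b r) = D :=
        Finset.add_sum_erase J (fun r => 1 - x b r) hi
      rcases (sub_nonneg.2 (hx b i).2).eq_or_lt with h | h
      · rw [← h]; simp
      · rw [div_eq_mul_inv]
        refine mul_le_mul_of_nonneg_left ?_ h.le
        exact inv_anti₀ (by linarith [hS i b]) (by linarith [(hx b i).1])
    refine (Finset.sum_le_sum hle).trans ?_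
    rw [← Finset.sum_div]
    exact div_self_le_one D
  have hstep : ∀ i ∈ J, ∑ b, x b i * A i b ≤ a / (1 - a) * ∑ b, (1 - x b i) * A i b := by
    intro i hi
    have e1 : ∑ b, x b i * A i b = (∑ t, f t) / Fintype.card B * ∑ b, A i b := by
      rw [← sum_mul_of_update_invariant f (A i) i (hA i)]
      exact Finset.sum_congr rfl fun b _ => by rw [hxJ b i hi]
    have e2 : ∑ b, (1 - x b i) * A i b = (∑ t, (1 - f t)) / Fintype.card B * ∑ b, A i b := by
      rw [← sum_mul_of_update_invariant (fun t => 1 - f t) (A i) i (hA i)]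
      exact Finset.sum_congr rfl fun b _ => by rw [hxJ b i hi]
    rw [e1, e2, ← mul_assoc]
    refine mul_le_mul_of_nonneg_right ?_ (Finset.sum_nonneg fun b _ => hA0 i b)
    have h1a : 0 < 1 - a := sub_pos.2 ha
    rw [Finset.sum_sub_distrib]
    simp only [Finset.sum_const, Finset.card_univ, nsmul_eq_mul, mul_one]
    rw [sub_div, div_self hn.ne']
    have : (∑ t, f t) / Fintype.card B ≤ a := by
      rw [div_le_iff₀ hn]; linarith
    calc (∑ t, f t) / Fintype.card B ≤ a := this
      _ = a / (1 - a) * (1 - a) := by field_simp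
      _ ≤ _ := mul_le_mul_of_nonneg_left (by linarith) (by positivity)
  calc ∑ b, nullRatio J (x b) p ≤ ∑ b, ∑ i ∈ J, x b i * A i b := by
        refine Finset.sum_le_sum fun b _ => ?_
        rw [nullRatio, hall, Finset.sum_div]
        refine Finset.sum_le_sum fun i hi => ?_
        rw [div_eq_mul_inv]
        refine mul_le_mul_of_nonneg_left ?_ (hx b i).1
        refine inv_anti₀ (by linarith [hS i b]) ?_
        have := Finset.add_sum_erase J (fun r => 1 - x b r) hi
        linarith [(hx b i).2]
    _ = ∑ i ∈ J, ∑ b, x b i * A i b := Finset.sum_comm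
    _ ≤ ∑ i ∈ J, a / (1 - a) * ∑ b, (1 - x b i) * A i b := Finset.sum_le_sum hstep
    _ = a / (1 - a) * ∑ b, ∑ i ∈ J, (1 - x b i) * A i b := by
        rw [← Finset.mul_sum, Finset.sum_comm]
    _ ≤ a / (1 - a) * ∑ b : Fin p → B, 1 := by
        refine mul_le_mul_of_nonneg_left (Finset.sum_le_sum fun b _ => hone b) ?_
        have : 0 < 1 - a := sub_pos.2 ha
        positivity
    _ = _ := by simp [mul_comm]

end Knockoff

namespace Knockoff

/-! ### Binomial p-values -/

lemma pValue_mem (m : ℕ) (c : ℝ) : pValue m c ∈ Set.Icc (0 : ℝ) 1 := by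
  have h2 : (0 : ℝ) < 2 ^ m := by positivity
  refine ⟨by unfold pValue; positivity, ?_⟩
  rw [pValue, div_le_one h2]
  calc _ ≤ ∑ i ∈ Finset.range (m + 1), (m.choose i : ℝ) :=
        Finset.sum_le_sum_of_subset_of_nonneg (Finset.filter_subset _ _) fun _ _ _ => by positivity
    _ = 2 ^ m := by exact_mod_cast Nat.sum_range_choose m

lemma pValue_zero (m : ℕ) : pValue m (0 : ℕ) = 1 := by
  have h2 : (2 : ℝ) ^ m ≠ 0 := by positivity
  rw [pValue, div_eq_one_iff_eq h2, Finset.filter_true_of_mem fun i _ => by simp]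
  exact_mod_cast Nat.sum_range_choose m

lemma pValue_succ_self (m : ℕ) : pValue m (m + 1 : ℕ) = 0 := by
  rw [pValue, Finset.filter_false_of_mem fun i hi => by
    rw [not_le, Nat.cast_lt]; exact Finset.mem_range.1 hi]
  simp

lemma pValue_sub_succ (m c : ℕ) (hc : c ≤ m) :
    pValue m c - pValue m (c + 1 : ℕ) = m.choose c / 2 ^ m := by
  have hs : (Finset.range (m + 1)).filter (fun i : ℕ => (c : ℝ) ≤ i) =
      insert c ((Finset.range (m + 1)).filter (fun i : ℕ => ((c + 1 : ℕ) : ℝ) ≤ i)) := by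
    ext i
    simp only [Finset.mem_filter, Finset.mem_range, Finset.mem_insert, Nat.cast_le]
    omega
  rw [pValue, pValue, hs, Finset.sum_insert (by simp), ← sub_div, add_sub_cancel_right]

/-- Sums over sign patterns of a function of the number of plus signs. -/
lemma sum_signs_eq (m : ℕ) (h : ℝ → ℝ) :
    ∑ b : Fin m → ℤˣ, h ((m : ℝ) / 2 + 1 / 2 * ∑ i, ((b i : ℤ) : ℝ)) =
      ∑ c ∈ Finset.range (m + 1), (m.choose c : ℝ) * h c := by
  let e : (Fin m → ℤˣ) ≃ Finset (Fin m) :=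
    { toFun := fun b => Finset.univ.filter fun i => b i = 1
      invFun := fun s i => if i ∈ s then 1 else -1
      left_inv := fun b => by
        funext i
        rcases Int.units_eq_one_or (b i) with h | h <;> simp [h]
      right_inv := fun s => by ext i; simp }
  have h1 : ∑ b : Fin m → ℤˣ, h ((m : ℝ) / 2 + 1 / 2 * ∑ i, ((b i : ℤ) : ℝ)) =
      ∑ s : Finset (Fin m), h s.card := by
    refine Fintype.sum_equiv e _ _ fun b => ?_
    congr 1
    have h3 : ∀ i, ((b i : ℤ) : ℝ) = 2 * (if b i = 1 then (1 : ℝ) else 0) - 1 := by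
      intro i
      rcases Int.units_eq_one_or (b i) with h | h <;> norm_num [h]
    rw [Finset.sum_congr rfl fun i _ => h3 i, Finset.sum_sub_distrib, ← Finset.mul_sum]
    simp only [Finset.sum_boole, Finset.sum_const, Finset.card_univ, Fintype.card_fin,
      nsmul_eq_mul, mul_one, e, Equiv.coe_fn_mk]
    ring
  rw [h1, ← Finset.powerset_univ, Finset.sum_powerset_apply_card (fun k => h k)]
  simp

lemma IsConfidence.intervalIntegrable {conf : ℝ → ℝ} (hconf : IsConfidence conf) {a b : ℝ}
    (ha : a ∈ Set.Icc (0 : ℝ) 1) (hb : b ∈ Set.Icc (0 : ℝ) 1) :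
    IntervalIntegrable conf volume a b :=
  (hconf.antitone.mono (Set.uIcc_subset_Icc ha hb)).intervalIntegrable

lemma meanConf_eq_intervalIntegral (conf : ℝ → ℝ) : meanConf conf = ∫ u in (0 : ℝ)..1, conf u := by
  rw [meanConf, intervalIntegral.integral_of_le zero_le_one, integral_Icc_eq_integral_Ioc]

lemma IsConfidence.meanConf_nonneg {conf : ℝ → ℝ} (hconf : IsConfidence conf) :
    0 ≤ meanConf conf :=
  setIntegral_nonneg measurableSet_Icc fun _ hu => (hconf.mapsTo hu).1

/-- The p-value of a uniformly random sign pattern is stochastically larger than a uniform variable,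
so its mean confidence is at most that of a uniform variable: the sum is the lower Riemann sum of
`conf` at the atoms of the p-value. -/
lemma IsConfidence.sum_conf_pValue_le {conf : ℝ → ℝ} (hconf : IsConfidence conf) (m : ℕ) :
    ∑ b : Fin m → ℤˣ, conf (pValue m ((m : ℝ) / 2 + 1 / 2 * ∑ i, ((b i : ℤ) : ℝ))) ≤
      Fintype.card (Fin m → ℤˣ) * meanConf conf := by
  have h2 : (0 : ℝ) < 2 ^ m := by positivity
  rw [sum_signs_eq m fun c => conf (pValue m c)]
  have hcard : (Fintype.card (Fin m → ℤˣ) : ℝ) = 2 ^ m := by simp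
  rw [hcard, meanConf_eq_intervalIntegral]
  have hsum := intervalIntegral.sum_integral_adjacent_intervals (f := conf) (μ := volume)
    (a := fun c : ℕ => pValue m c) (n := m + 1)
    fun k _ => hconf.intervalIntegrable (pValue_mem m _) (pValue_mem m _)
  rw [pValue_zero, pValue_succ_self, intervalIntegral.integral_symm 0 1] at hsum
  rw [← neg_eq_iff_eq_neg.2 hsum, ← Finset.sum_neg_distrib, Finset.mul_sum]
  refine Finset.sum_le_sum fun c hc => ?_
  have hcm : c ≤ m := Nat.lt_succ_iff.1 (Finset.mem_range.1 hc)
  have hd := pValue_sub_succ m c hcm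
  have hle : pValue m (c + 1 : ℕ) ≤ pValue m c := by
    have : (0 : ℝ) ≤ m.choose c / 2 ^ m := by positivity
    linarith
  rw [← intervalIntegral.integral_symm]
  have hmono : ∫ _ in pValue m (c + 1 : ℕ)..pValue m c, conf (pValue m c) ≤
      ∫ u in pValue m (c + 1 : ℕ)..pValue m c, conf u := by
    refine intervalIntegral.integral_mono_on hle intervalIntegrable_const
      (hconf.intervalIntegrable (pValue_mem m _) (pValue_mem m _)) fun u hu => ?_
    exact hconf.antitone ⟨(pValue_mem m _).1.trans hu.1, hu.2.trans (pValue_mem m _).2⟩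
      (pValue_mem m _) hu.2
  rw [intervalIntegral.integral_const, hd, smul_eq_mul] at hmono
  calc (m.choose c : ℝ) * conf (pValue m c)
      = 2 ^ m * (m.choose c / 2 ^ m * conf (pValue m c)) := by field_simp
    _ ≤ _ := mul_le_mul_of_nonneg_left hmono h2.le

/-! ### The false discovery proportion averaged over sign patterns -/

lemma wFDP_nonneg {p : ℕ} (null : Fin p → Prop) {w : Fin p → ℝ} (hw : ∀ j, 0 ≤ w j) :
    0 ≤ wFDP null w := by
  unfold wFDP
  split_ifs with h
  · exact div_nonneg (Finset.sum_nonneg fun j _ => hw j) h.le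
  · exact le_rfl

lemma wFDP_le_one {p : ℕ} (null : Fin p → Prop) {w : Fin p → ℝ} (hw : ∀ j, 0 ≤ w j) :
    wFDP null w ≤ 1 := by
  classical
  unfold wFDP
  split_ifs with h
  · rw [div_le_one h]
    exact Finset.sum_le_sum_of_subset_of_nonneg (Finset.filter_subset _ _) fun j _ _ => hw j
  · exact zero_le_one

lemma weights_nonneg {p : ℕ} {q : ℝ} {conf : ℝ → ℝ} (hconf : IsConfidence conf) {P : Fin p → ℝ}
    (hP : ∀ j, P j ∈ Set.Icc (0 : ℝ) 1) (ρ : Equiv.Perm (Fin p)) (j : Fin p) :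
    0 ≤ weights q conf P ρ j := by
  unfold weights
  split_ifs
  exacts [(hconf.mapsTo (hP j)).1, le_rfl]

lemma kHat_eq_lastPass {p : ℕ} (q : ℝ) (conf : ℝ → ℝ) (P : Fin p → ℝ) (ρ : Equiv.Perm (Fin p)) :
    kHat q conf P ρ = lastPass (q / meanConf conf - q) fun r => conf (P (ρ r)) := rfl

/-- The stopping condition bounds the false discovery proportion by a multiple of the null ratio
at the stopping index. -/
lemma wFDP_weights_le {p : ℕ} {q : ℝ} {conf : ℝ → ℝ} (hconf : IsConfidence conf) {P : Fin p → ℝ}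
    (hP : ∀ j, P j ∈ Set.Icc (0 : ℝ) 1) (ρ : Equiv.Perm (Fin p)) (null : Fin p → Prop)
    {J : Finset (Fin p)} (hJ : ∀ r, r ∈ J ↔ null (ρ r)) :
    wFDP null (weights q conf P ρ) ≤ max 0 (q / meanConf conf - q) *
      nullRatio J (fun r => conf (P (ρ r)))
        (lastPass (q / meanConf conf - q) fun r => conf (P (ρ r))) := by
  classical
  set C := q / meanConf conf - q
  set x : Fin p → ℝ := fun r => conf (P (ρ r)) with hx
  have hx0 : ∀ r, 0 ≤ x r := fun r => (hconf.mapsTo (hP _)).1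
  have hx1 : ∀ r, x r ≤ 1 := fun r => (hconf.mapsTo (hP _)).2
  set k := lastPass C x with hk
  have hN : ∀ s : Finset (Fin p), 0 ≤ ∑ r ∈ s, x r := fun s => Finset.sum_nonneg fun r _ => hx0 r
  have hD : ∀ s : Finset (Fin p), 0 ≤ ∑ r ∈ s, (1 - x r) :=
    fun s => Finset.sum_nonneg fun r _ => sub_nonneg.2 (hx1 r)
  have hratio : 0 ≤ nullRatio J x k := div_nonneg (hN _) (by linarith [hD (nullsBelow J k)])
  have hw : ∀ r, weights q conf P ρ (ρ r) = if r.val < k then x r else 0 := by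
    intro r
    simp [weights, kHat_eq_lastPass, hk, hx, C]
  have htot : ∑ j, weights q conf P ρ j = ∑ r : Fin p with r.val < k, x r := by
    rw [← Equiv.sum_comp ρ, Finset.sum_congr rfl fun r _ => hw r, Finset.sum_filter]
  have hnull : ∑ j with null j, weights q conf P ρ j = ∑ r ∈ nullsBelow J k, x r := by
    rw [Finset.sum_filter, ← Equiv.sum_comp ρ, nullsBelow, Finset.sum_filter,
      ← Finset.sum_filter_add_sum_filter_not Finset.univ (· ∈ J)]
    rw [Finset.sum_congr (s₁ := Finset.univ.filter (· ∈ J)) (s₂ := J)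
      (g := fun r => if r.val < k then x r else 0) (by simp) fun r hr => by
        rw [if_pos ((hJ r).1 hr), hw],
      Finset.sum_congr (s₁ := Finset.univ.filter (· ∉ J)) (g := fun _ => (0 : ℝ)) rfl fun r hr => by
        rw [if_neg fun h => (Finset.mem_filter.1 hr).2 ((hJ r).2 h)]]
    simp
  unfold wFDP
  split_ifs with hpos
  swap
  · positivity
  rw [htot] at hpos
  have hk0 : 0 < k := by
    by_contra h
    simp [Nat.eq_zero_of_not_pos h] at hpos
  have hpass := (passesAt_lastPass C x hk0).2
  rw [← hk] at hpass
  have hsub : nullsBelow J k ⊆ Finset.univ.filter fun r : Fin p => r.val < k :=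
    Finset.filter_subset_filter _ (Finset.subset_univ J)
  have hDle := Finset.sum_le_sum_of_subset_of_nonneg (f := fun r => 1 - x r) hsub
    fun r _ _ => sub_nonneg.2 (hx1 r)
  rw [htot]
  calc (∑ j with null j, weights q conf P ρ j) / ∑ r : Fin p with r.val < k, x r
      = (1 + ∑ r ∈ nullsBelow J k, (1 - x r)) / (∑ r : Fin p with r.val < k, x r) *
          nullRatio J x k := by
        have : 1 + ∑ r ∈ nullsBelow J k, (1 - x r) ≠ 0 := by linarith [hD (nullsBelow J k)]
        rw [hnull, nullRatio]
        field_simp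
    _ ≤ max 0 C * nullRatio J x k := by
        refine mul_le_mul_of_nonneg_right (le_max_of_le_right (le_trans ?_ hpass)) hratio
        exact div_le_div_of_nonneg_right (by linarith) hpos.le

/-- For frozen ordering and frozen non-null statistics, the weighted false discovery proportion is
at most `q` on average over all sign patterns of the nulls. -/
theorem sum_wFDP_signs_le {m p : ℕ} {q : ℝ} (hq0 : 0 < q) {conf : ℝ → ℝ}
    (hconf : IsConfidence conf) (ρ : Equiv.Perm (Fin p)) (null : Fin p → Prop)
    [DecidablePred null] (c : Fin p → ℝ) :
    ∑ b : Fin p → Fin m → ℤˣ, wFDP null (weights q conf (fun j => pValue m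
      (if null j then (m : ℝ) / 2 + 1 / 2 * ∑ i, ((b j i : ℤ) : ℝ) else c j)) ρ) ≤
      Fintype.card (Fin p → Fin m → ℤˣ) * q := by
  set C := q / meanConf conf - q with hC
  set J : Finset (Fin p) := Finset.univ.filter fun r => null (ρ r) with hJ
  let f : (Fin m → ℤˣ) → ℝ := fun t => conf (pValue m ((m : ℝ) / 2 + 1 / 2 * ∑ i, ((t i : ℤ) : ℝ)))
  let c' : Fin p → ℝ := fun r => conf (pValue m (c (ρ r)))
  have hf : ∀ t, f t ∈ Set.Icc (0 : ℝ) 1 := fun t => hconf.mapsTo (pValue_mem m _)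
  have hc' : ∀ r, c' r ∈ Set.Icc (0 : ℝ) 1 := fun r => hconf.mapsTo (pValue_mem m _)
  have hx : ∀ b : Fin p → Fin m → ℤˣ, (fun r => conf (pValue m
      (if null (ρ r) then (m : ℝ) / 2 + 1 / 2 * ∑ i, ((b (ρ r) i : ℤ) : ℝ) else c (ρ r)))) =
      patternWeights J f c' (b ∘ ρ) := by
    intro b
    funext r
    by_cases h : null (ρ r) <;> simp [patternWeights, hJ, h, f, c']
  have hle : ∀ b : Fin p → Fin m → ℤˣ, wFDP null (weights q conf (fun j => pValue m
      (if null j then (m : ℝ) / 2 + 1 / 2 * ∑ i, ((b j i : ℤ) : ℝ) else c j)) ρ) ≤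
      max 0 C * nullRatio J (patternWeights J f c' (b ∘ ρ))
        (lastPass C (patternWeights J f c' (b ∘ ρ))) := by
    intro b
    rw [← hx b]
    exact wFDP_weights_le hconf (fun j => pValue_mem m _) ρ null (by simp [hJ])
  refine (Finset.sum_le_sum fun b _ => hle b).trans ?_
  rw [← Finset.mul_sum, Fintype.sum_equiv (ρ.symm.arrowCongr (Equiv.refl (Fin m → ℤˣ)))
    (fun b => nullRatio J (patternWeights J f c' (b ∘ ρ))
      (lastPass C (patternWeights J f c' (b ∘ ρ))))
    (fun b => nullRatio J (patternWeights J f c' b) (lastPass C (patternWeights J f c' b)))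
    fun b => rfl]
  have hcard : (0 : ℝ) ≤ Fintype.card (Fin p → Fin m → ℤˣ) := Nat.cast_nonneg _
  rcases le_or_gt C 0 with hC0 | hC0
  · rw [max_eq_left hC0, zero_mul]
    positivity
  rw [max_eq_right hC0.le]
  -- a positive threshold forces the mean confidence into `(0, 1)`
  have ha0 : 0 < meanConf conf := by
    refine hconf.meanConf_nonneg.lt_of_ne fun h => ?_
    rw [hC, ← h, div_zero] at hC0
    linarith
  have ha1 : meanConf conf < 1 := by
    have h : q * 1 < q / meanConf conf := by linarith
    rw [lt_div_iff₀ ha0] at h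
    nlinarith
  have hodds : 0 < 1 - meanConf conf := sub_pos.2 ha1
  calc C * ∑ b, nullRatio J (patternWeights J f c' b) (lastPass C (patternWeights J f c' b))
      ≤ C * (Fintype.card (Fin p → Fin m → ℤˣ) * (meanConf conf / (1 - meanConf conf))) := by
        refine mul_le_mul_of_nonneg_left ?_ hC0.le
        exact (sum_nullRatio_lastPass_le hf hc' C).trans
          (sum_nullRatio_all_le hf hc' ha0.le ha1 (hconf.sum_conf_pValue_le m))
    _ = Fintype.card (Fin p → Fin m → ℤˣ) * q := by
        rw [hC]; field_simp

end Knockoff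

namespace Knockoff

/-! ### Exchanging columns by an isometry -/

/-- The `a`-th column of the augmented design `[X, Xk]` as a Euclidean vector. -/
noncomputable def column {n p : ℕ} (X Xk : Matrix (Fin n) (Fin p) ℝ) (a : Fin p ⊕ Fin p) :
    EuclideanSpace ℝ (Fin n) :=
  WithLp.toLp 2 fun k => fromCols X Xk k a

lemma inner_column {n p : ℕ} (X Xk : Matrix (Fin n) (Fin p) ℝ) (a : Fin p ⊕ Fin p)
    (y : EuclideanSpace ℝ (Fin n)) :
    inner ℝ (column X Xk a) y = ((fromCols X Xk)ᵀ *ᵥ y.ofLp) a := by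
  simp [column, PiLp.inner_apply, mulVec, dotProduct, mul_comm]

lemma inner_column_column {n p : ℕ} (X Xk : Matrix (Fin n) (Fin p) ℝ) (a b : Fin p ⊕ Fin p) :
    inner ℝ (column X Xk a) (column X Xk b) = ((fromCols X Xk)ᵀ * fromCols X Xk) a b := by
  rw [inner_column]
  simp [column, mulVec, Matrix.mul_apply, dotProduct]

lemma swapCols_empty {p : ℕ} (a : Fin p ⊕ Fin p) : swapCols ∅ a = a := by
  cases a <;> simp [swapCols]

lemma swapCols_insert {p : ℕ} {S : Finset (Fin p)} {j : Fin p} (hj : j ∉ S) (a : Fin p ⊕ Fin p) :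
    swapCols (insert j S) a = swapCols {j} (swapCols S a) := by
  rcases a with i | i <;> by_cases hi : i ∈ S <;> by_cases hij : i = j <;>
    simp_all [swapCols]

variable {n p : ℕ} {X Xk : Matrix (Fin n) (Fin p) ℝ}

/-- The reflection along `X_j - X̃_j` exchanges these two columns and fixes all others, since the
knockoff conditions make the others orthogonal to `X_j - X̃_j`. -/
lemma IsKnockoff.exists_isometry_singleton (h : IsKnockoff X Xk) (j : Fin p) :
    ∃ Q : EuclideanSpace ℝ (Fin n) ≃ₗᵢ[ℝ] EuclideanSpace ℝ (Fin n),
      ∀ a, Q (column X Xk a) = column X Xk (swapCols {j} a) := by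
  obtain ⟨s, -, h1, h2⟩ := h
  have hll : ∀ i l, inner ℝ (column X Xk (.inl i)) (column X Xk (.inl l)) = (Xᵀ * X) i l := by
    intro i l
    rw [inner_column_column]; simp [Matrix.mul_apply]
  have hrr : ∀ i l, inner ℝ (column X Xk (.inr i)) (column X Xk (.inr l)) = (Xᵀ * X) i l := by
    intro i l
    rw [inner_column_column, ← h1]; simp [Matrix.mul_apply]
  have hlr : ∀ i l, inner ℝ (column X Xk (.inl i)) (column X Xk (.inr l)) =
      (Xᵀ * X) i l - Matrix.diagonal s i l := by
    intro i l
    rw [inner_column_column, ← Matrix.sub_apply, ← h2]; simp [Matrix.mul_apply]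
  have hsymm : ∀ i l, (Xᵀ * X) i l = (Xᵀ * X) l i := by
    intro i l
    simp only [Matrix.mul_apply, Matrix.transpose_apply, mul_comm]
  set v := column X Xk (.inl j)
  set w := column X Xk (.inr j)
  have hnorm : ‖v‖ = ‖w‖ := by
    rw [← sq_eq_sq₀ (norm_nonneg _) (norm_nonneg _), ← real_inner_self_eq_norm_sq,
      ← real_inner_self_eq_norm_sq, hll, hrr]
  have hfix : ∀ x, inner ℝ v x = inner ℝ w x →
      (ℝ ∙ (v - w))ᗮ.reflection x = x := by
    intro x hx
    refine Submodule.reflection_mem_subspace_eq_self ?_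
    rw [Submodule.mem_orthogonal_singleton_iff_inner_right, inner_sub_left, hx, sub_self]
  refine ⟨(ℝ ∙ (v - w))ᗮ.reflection, ?_⟩
  rintro (i | i)
  · by_cases hi : i = j
    · subst hi
      simpa [swapCols] using Submodule.reflection_sub hnorm
    · rw [show swapCols {j} (Sum.inl i) = Sum.inl i by simp [swapCols, hi]]
      refine hfix _ ?_
      rw [hll, real_inner_comm, hlr, Matrix.diagonal_apply_ne _ hi, sub_zero, hsymm]
  · by_cases hi : i = j
    · subst hi
      have := congrArg (ℝ ∙ (v - w))ᗮ.reflection (Submodule.reflection_sub hnorm)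
      rw [Submodule.reflection_reflection] at this
      simpa [swapCols] using this.symm
    · rw [show swapCols {j} (Sum.inr i) = Sum.inr i by simp [swapCols, hi]]
      refine hfix _ ?_
      rw [hlr, hrr, Matrix.diagonal_apply_ne _ (Ne.symm hi), sub_zero]

lemma IsKnockoff.exists_isometry (h : IsKnockoff X Xk) (S : Finset (Fin p)) :
    ∃ Q : EuclideanSpace ℝ (Fin n) ≃ₗᵢ[ℝ] EuclideanSpace ℝ (Fin n),
      ∀ a, Q (column X Xk a) = column X Xk (swapCols S a) := by
  induction S using Finset.induction_on with
  | empty => exact ⟨.refl ℝ _, fun a => by simp [swapCols_empty]⟩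
  | insert j S hj ih =>
    obtain ⟨Q, hQ⟩ := ih
    obtain ⟨R, hR⟩ := h.exists_isometry_singleton j
    exact ⟨Q.trans R, fun a => by simp [hQ, hR, swapCols_insert hj]⟩

/-- Isotropic Gaussian noise is invariant under linear isometries. -/
lemma measurePreserving_isometry_gaussian (v : ℝ≥0)
    (Q : EuclideanSpace ℝ (Fin n) ≃ₗᵢ[ℝ] EuclideanSpace ℝ (Fin n)) :
    MeasurePreserving (fun z : Fin n → ℝ => (Q (WithLp.toLp 2 z)).ofLp)
      (Measure.pi fun _ => gaussianReal 0 v) (Measure.pi fun _ => gaussianReal 0 v) := by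
  set ν : Measure (Fin n → ℝ) := Measure.pi fun _ => gaussianReal 0 v with hν
  have hmeas : Measurable fun z : Fin n → ℝ => (Q (WithLp.toLp 2 z)).ofLp := by fun_prop
  refine ⟨hmeas, ?_⟩
  have hchar : ∀ t : EuclideanSpace ℝ (Fin n),
      charFun (ν.map (WithLp.toLp 2)) t = Complex.exp (-(v * ‖t‖ ^ 2 / 2 : ℝ)) := by
    intro t
    rw [hν, charFun_pi]
    simp_rw [charFun_gaussianReal, ← Complex.exp_sum, EuclideanSpace.real_norm_sq_eq]
    congr 1
    push_cast
    simp [Finset.mul_sum, Finset.sum_div]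
  have : IsProbabilityMeasure (ν.map fun z : Fin n → ℝ => (Q (WithLp.toLp 2 z)).ofLp) :=
    Measure.isProbabilityMeasure_map hmeas.aemeasurable
  refine (charFun_eq_pi_iff (μ := fun _ : Fin n => gaussianReal 0 v)).1 fun t => ?_
  rw [← charFun_pi, ← hν, hchar, ← Q.symm.norm_map t, ← hchar, Measure.map_map (by fun_prop) hmeas,
    charFun_apply, charFun_apply, integral_map (by fun_prop) (by fun_prop),
    integral_map (by fun_prop) (by fun_prop)]
  congr 1
  funext z
  congr 3
  simp only [Function.comp_apply, WithLp.toLp_ofLp]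
  rw [← Q.inner_map_map (WithLp.toLp 2 z), Q.apply_symm_apply]

/-- The symmetry behind the knockoff method: exchanging columns at nulls is realised by a
transformation of the noise that preserves its law. -/
lemma IsKnockoff.exists_measurePreserving (h : IsKnockoff X Xk) {β : Fin p → ℝ}
    {S : Finset (Fin p)} (hS : ∀ j ∈ S, β j = 0) (v : ℝ≥0) :
    ∃ φ : (Fin n → ℝ) → (Fin n → ℝ),
      MeasurePreserving φ (Measure.pi fun _ => gaussianReal 0 v)
        (Measure.pi fun _ => gaussianReal 0 v) ∧
      ∀ (T : Statistic p) (z : Fin n → ℝ),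
        T.Z X Xk (X *ᵥ β + φ z) = T.Z X Xk (X *ᵥ β + z) ∘ swapCols S := by
  obtain ⟨Q, hQ⟩ := h.exists_isometry S
  refine ⟨_, measurePreserving_isometry_gaussian v Q.symm, fun T z => ?_⟩
  set G := (fromCols X Xk)ᵀ * fromCols X Xk with hG
  have hGswap : G.submatrix (swapCols S) (swapCols S) = G := by
    ext a b
    rw [Matrix.submatrix_apply, hG, ← inner_column_column, ← inner_column_column, ← hQ, ← hQ,
      Q.inner_map_map]
  -- the isometry fixes the mean, which is a combination of columns outside `S`
  have hmean : WithLp.toLp 2 (X *ᵥ β) = ∑ j, β j • column X Xk (.inl j) := by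
    ext k
    simp [column, mulVec, dotProduct, mul_comm]
  have hfix : Q (WithLp.toLp 2 (X *ᵥ β)) = WithLp.toLp 2 (X *ᵥ β) := by
    rw [hmean, map_sum]
    refine Finset.sum_congr rfl fun j _ => ?_
    rw [map_smul, hQ]
    by_cases hj : j ∈ S
    · simp [hS j hj]
    · simp [swapCols, hj]
  set y := X *ᵥ β + z with hy
  have hy' : X *ᵥ β + (Q.symm (WithLp.toLp 2 z)).ofLp = (Q.symm (WithLp.toLp 2 y)).ofLp := by
    rw [hy, WithLp.toLp_add, map_add, Q.symm_apply_eq.2 hfix.symm]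
    rfl
  rw [hy']
  have hu : (fromCols X Xk)ᵀ *ᵥ (Q.symm (WithLp.toLp 2 y)).ofLp =
      ((fromCols X Xk)ᵀ *ᵥ y) ∘ swapCols S := by
    funext a
    rw [← inner_column, ← Q.inner_map_map, hQ, Q.apply_symm_apply, inner_column]
    rfl
  have ht : (Q.symm (WithLp.toLp 2 y)).ofLp ⬝ᵥ (Q.symm (WithLp.toLp 2 y)).ofLp = y ⬝ᵥ y := by
    have key : ∀ x : EuclideanSpace ℝ (Fin n), x.ofLp ⬝ᵥ x.ofLp = ‖x‖ ^ 2 := by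
      intro x
      rw [EuclideanSpace.real_norm_sq_eq]
      simp [dotProduct, sq]
    rw [key, Q.symm.norm_map, ← key]
  rw [Statistic.Z, Statistic.Z, hu, ht, ← hG, ← T.pilot_swap, hGswap]

lemma Statistic.chi_of_swap (T : Statistic p) {S : Finset (Fin p)} {y y' : Fin n → ℝ}
    (h : T.Z X Xk y' = T.Z X Xk y ∘ swapCols S) (j : Fin p) :
    T.chi X Xk y' j = if j ∈ S then -T.chi X Xk y j else T.chi X Xk y j := by
  by_cases hj : j ∈ S
  · simp [Statistic.chi, h, swapCols, hj, ← Real.sign_neg]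
  · simp [Statistic.chi, h, swapCols, hj]

lemma Statistic.W_of_swap (T : Statistic p) {S : Finset (Fin p)} {y y' : Fin n → ℝ}
    (h : T.Z X Xk y' = T.Z X Xk y ∘ swapCols S) : T.W X Xk y' = T.W X Xk y := by
  rw [Statistic.W, Statistic.W, h, T.ordering_swap]

lemma Statistic.measurable_Z (T : Statistic p) : Measurable (T.Z X Xk) := by
  unfold Statistic.Z
  have h1 : Measurable fun y : Fin n → ℝ => (fromCols X Xk)ᵀ *ᵥ y := by
    unfold mulVec dotProduct; fun_prop
  have h2 : Measurable fun y : Fin n → ℝ => y ⬝ᵥ y := by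
    unfold dotProduct; fun_prop
  exact (T.measurable_pilot _).comp (h1.prodMk h2)

lemma Statistic.measurable_W (T : Statistic p) : Measurable (T.W X Xk) :=
  T.measurable_ordering.comp T.measurable_Z

end Knockoff

namespace Knockoff

/-! ### Integrating over the noise -/

/-- The law of the noise of all models: independent isotropic Gaussian vectors. -/
noncomputable def noiseLaw (n : ℕ → ℕ) (v : ℕ → ℝ≥0) : Measure (∀ i, Fin (n i) → ℝ) :=
  Measure.infinitePi fun i => Measure.pi fun _ => gaussianReal 0 (v i)

instance (n : ℕ → ℕ) (v : ℕ → ℝ≥0) : IsProbabilityMeasure (noiseLaw n v) := by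
  unfold noiseLaw; infer_instance

/-- The weighted false discovery proportion for the first `k` models, as a function of the
noise. -/
noncomputable def noiseFDP {p : ℕ} {n : ℕ → ℕ} (k : ℕ)
    (X Xk : ∀ i, Matrix (Fin (n i)) (Fin p) ℝ) (β : ℕ → Fin p → ℝ) (T : ℕ → Statistic p)
    (Γ : (Fin k → ℝ≥0) → ℝ≥0) (ρ : (Fin p → ℝ≥0) → Equiv.Perm (Fin p)) (q : ℝ) (conf : ℝ → ℝ)
    (z : ∀ i, Fin (n i) → ℝ) : ℝ :=
  wFDP (IsNull β k) (procedure k X Xk T Γ ρ q conf fun i => X i *ᵥ β i + z i)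

variable {p : ℕ} {n : ℕ → ℕ} {X Xk : ∀ i, Matrix (Fin (n i)) (Fin p) ℝ} {β : ℕ → Fin p → ℝ}
  {T : ℕ → Statistic p} {k : ℕ} {Γ : (Fin k → ℝ≥0) → ℝ≥0}
  {ρ : (Fin p → ℝ≥0) → Equiv.Perm (Fin p)} {q : ℝ} {conf : ℝ → ℝ}

/-- The proportion is a function of finitely many signs and of the ranking, which take finitely many
values; so no regularity of `conf` is needed. -/
lemma measurable_noiseFDP (hΓ : Measurable Γ) (hρ : IsRankingRule ρ) :
    Measurable (noiseFDP k X Xk β T Γ ρ q conf) := by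
  classical
  let _ : MeasurableSpace (Equiv.Perm (Fin p)) := ⊤
  let y : (∀ i, Fin (n i) → ℝ) → ∀ i, Fin (n i) → ℝ := fun z i => X i *ᵥ β i + z i
  have hy : ∀ i, Measurable fun z => y z i := by intro i; fun_prop
  let d : (∀ i, Fin (n i) → ℝ) → Fin k → Fin p → ℝ := fun z i j =>
    (T i).Z (X i) (Xk i) (y z i) (.inl j) - (T i).Z (X i) (Xk i) (y z i) (.inr j)
  have hd : ∀ i j, Measurable fun z => d z i j := by
    intro i j
    have h := (T i).measurable_Z (X := X i) (Xk := Xk i) |>.comp (hy i)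
    exact ((measurable_pi_apply _).comp h).sub ((measurable_pi_apply _).comp h)
  let D : (∀ i, Fin (n i) → ℝ) → (Fin k → Fin p → Prop × Prop) × Equiv.Perm (Fin p) := fun z =>
    (fun i j => (d z i j < 0, 0 < d z i j),
      ρ (aggW Γ fun i : Fin k => (T i).W (X i) (Xk i) (y z i)))
  let H : (Fin k → Fin p → Prop × Prop) × Equiv.Perm (Fin p) → ℝ := fun e =>
    wFDP (IsNull β k) (weights q conf (fun j => pValue k (aggChi (fun i j =>
      if (e.1 i j).1 then -1 else if (e.1 i j).2 then 1 else 0) j)) e.2)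
  have hD : Measurable D := by
    refine Measurable.prodMk ?_ ?_
    · refine measurable_pi_iff.2 fun i => measurable_pi_iff.2 fun j => Measurable.prodMk ?_ ?_
      · exact measurableSet_setOfPred.1 (measurableSet_lt (hd i j) measurable_const)
      · exact measurableSet_setOfPred.1 (measurableSet_lt measurable_const (hd i j))
    · have hW : Measurable fun z =>
          aggW Γ fun i : Fin k => (T i).W (X i) (Xk i) (y z i) := by
        refine measurable_pi_iff.2 fun j => hΓ.comp (measurable_pi_iff.2 fun i => ?_)
        exact (measurable_pi_apply j).comp ((T i).measurable_W.comp (hy i))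
      exact measurable_to_countable' fun σ => hW (hρ.measurable σ)
  have hH : Measurable H := measurable_of_countable H
  have : noiseFDP k X Xk β T Γ ρ q conf = H ∘ D := by
    funext z
    rfl
  rw [this]
  exact hH.comp hD

lemma noiseFDP_nonneg (hconf : IsConfidence conf) (z : ∀ i, Fin (n i) → ℝ) :
    0 ≤ noiseFDP k X Xk β T Γ ρ q conf z :=
  wFDP_nonneg _ fun j => weights_nonneg hconf (fun _ => pValue_mem _ _) _ j

lemma noiseFDP_le_one (hconf : IsConfidence conf) (z : ∀ i, Fin (n i) → ℝ) :
    noiseFDP k X Xk β T Γ ρ q conf z ≤ 1 :=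
  wFDP_le_one _ fun j => weights_nonneg hconf (fun _ => pValue_mem _ _) _ j

lemma integrable_noiseFDP (hΓ : Measurable Γ) (hρ : IsRankingRule ρ) (hconf : IsConfidence conf)
    (ν : Measure (∀ i, Fin (n i) → ℝ)) [IsFiniteMeasure ν] :
    Integrable (noiseFDP k X Xk β T Γ ρ q conf) ν :=
  .of_bound (measurable_noiseFDP hΓ hρ).aestronglyMeasurable 1 <| .of_forall fun z => by
    rw [Real.norm_of_nonneg (noiseFDP_nonneg hconf z)]
    exact noiseFDP_le_one hconf z

/-- Any pattern of sign flips at the true nulls is realised by a transformation of the noise that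
preserves its law and the ordering statistics. -/
lemma exists_flip (hXk : ∀ i, IsKnockoff (X i) (Xk i)) (v : ℕ → ℝ≥0) (T : ℕ → Statistic p)
    (ε : Fin p → Fin k → ℤˣ) [DecidablePred (IsNull β k)] :
    ∃ Φ : (∀ i, Fin (n i) → ℝ) → (∀ i, Fin (n i) → ℝ),
      MeasurePreserving Φ (noiseLaw n v) (noiseLaw n v) ∧
      ∀ z (i : Fin k),
        (T i).W (X i) (Xk i) (X i *ᵥ β i + Φ z i) = (T i).W (X i) (Xk i) (X i *ᵥ β i + z i) ∧
        ∀ j, (T i).chi (X i) (Xk i) (X i *ᵥ β i + Φ z i) j = if IsNull β k j then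
          ((ε j i : ℤ) : ℝ) * (T i).chi (X i) (Xk i) (X i *ᵥ β i + z i) j else
          (T i).chi (X i) (Xk i) (X i *ᵥ β i + z i) j := by
  let S : ℕ → Finset (Fin p) := fun i =>
    Finset.univ.filter fun j => IsNull β k j ∧ ∃ hi : i < k, ε j ⟨i, hi⟩ = -1
  have hS : ∀ i, ∀ j ∈ S i, β i j = 0 := by
    intro i j hj
    obtain ⟨-, hnull, hi, -⟩ := Finset.mem_filter.1 hj
    exact hnull i hi
  choose φ hφ hZ using fun i => (hXk i).exists_measurePreserving (hS i) (v i)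
  refine ⟨fun z i => φ i (z i), ⟨?_, ?_⟩, fun z i => ⟨?_, fun j => ?_⟩⟩
  · exact measurable_pi_iff.2 fun i => (hφ i).measurable.comp (measurable_pi_apply i)
  · rw [noiseLaw, Measure.infinitePi_map_pi _ fun i => (hφ i).measurable]
    congr 1
    funext i
    exact (hφ i).map_eq
  · exact (T i).W_of_swap (hZ i (T i) (z i))
  · rw [(T i).chi_of_swap (hZ i (T i) (z i))]
    by_cases hj : IsNull β k j
    · rcases Int.units_eq_one_or (ε j i) with h | h <;> simp [S, hj, h]
    · simp [S, hj]

/-- For a fixed number of models, the weighted false discovery rate is at most `q`. -/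
lemma integral_noiseFDP_le (hXk : ∀ i, IsKnockoff (X i) (Xk i)) (v : ℕ → ℝ≥0)
    (hT : ∀ i j, β i j = 0 →
      ∀ᵐ z ∂noiseLaw n v, (T i).chi (X i) (Xk i) (X i *ᵥ β i + z i) j ≠ 0)
    (hΓ : Measurable Γ) (hρ : IsRankingRule ρ) (hconf : IsConfidence conf) (hq0 : 0 < q) :
    ∫ z, noiseFDP k X Xk β T Γ ρ q conf z ∂noiseLaw n v ≤ q := by
  classical
  set F := noiseFDP k X Xk β T Γ ρ q conf with hF
  have hFm : Measurable F := measurable_noiseFDP hΓ hρ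
  have hFi := integrable_noiseFDP (X := X) (Xk := Xk) (β := β) (T := T) (q := q) hΓ hρ hconf
    (noiseLaw n v)
  choose Φ hΦ hflip using fun ε => exists_flip (k := k) (β := β) hXk v T ε
  have hae : ∀ᵐ z ∂noiseLaw n v, ∀ (i : Fin k) (j : Fin p), IsNull β k j →
      (T i).chi (X i) (Xk i) (X i *ᵥ β i + z i) j ≠ 0 := by
    simp only [ae_all_iff]
    exact fun i j hj => hT i j (hj i i.2)
  have hpt : ∀ᵐ z ∂noiseLaw n v,
      ∑ ε, F (Φ ε z) ≤ Fintype.card (Fin p → Fin k → ℤˣ) * q := by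
    filter_upwards [hae] with z hz
    let chi : Fin k → Fin p → ℝ := fun i => (T i).chi (X i) (Xk i) (X i *ᵥ β i + z i)
    have hsign : ∀ (j : Fin p) (i : Fin k), ∃ s : ℤˣ, IsNull β k j → chi i j = ((s : ℤ) : ℝ) := by
      intro j i
      by_cases hj : IsNull β k j
      · have h0 := hz i j hj
        rcases Real.sign_apply_eq ((T i).Z (X i) (Xk i) (X i *ᵥ β i + z i) (.inl j) -
          (T i).Z (X i) (Xk i) (X i *ᵥ β i + z i) (.inr j)) with h | h | h
        · exact ⟨-1, fun _ => by simpa [chi, Statistic.chi] using h⟩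
        · exact absurd h h0
        · exact ⟨1, fun _ => by simpa [chi, Statistic.chi] using h⟩
      · exact ⟨1, fun h => absurd h hj⟩
    choose s hs using hsign
    let σ := ρ (aggW Γ fun i : Fin k => (T i).W (X i) (Xk i) (X i *ᵥ β i + z i))
    let R : (Fin p → Fin k → ℤˣ) → ℝ := fun b => wFDP (IsNull β k) (weights q conf (fun j =>
      pValue k (if IsNull β k j then (k : ℝ) / 2 + 1 / 2 * ∑ i, ((b j i : ℤ) : ℝ)
        else aggChi chi j)) σ)
    have hR : ∀ ε, F (Φ ε z) = R (ε * s) := by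
      intro ε
      simp only [hF, noiseFDP, procedure, R, σ]
      congr 2
      · funext j
        congr 1
        by_cases hj : IsNull β k j
        · simp [aggChi, (hflip ε z _).2, hj, ← hs j _ hj, chi]
        · simp [aggChi, (hflip ε z _).2, hj, chi]
      · congr 2
        funext i
        exact (hflip ε z i).1
    calc ∑ ε, F (Φ ε z) = ∑ ε, R (ε * s) := Finset.sum_congr rfl fun ε _ => hR ε
      _ = ∑ b, R b := Fintype.sum_equiv (Equiv.mulRight s) _ _ fun ε => rfl
      _ ≤ _ := sum_wFDP_signs_le hq0 hconf σ (IsNull β k) fun j => aggChi chi j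
  have hinv : ∀ ε, ∫ z, F (Φ ε z) ∂noiseLaw n v = ∫ z, F z ∂noiseLaw n v := by
    intro ε
    rw [← integral_map (hΦ ε).measurable.aemeasurable hFm.aestronglyMeasurable, (hΦ ε).map_eq]
  have hint : ∀ ε, Integrable (fun z => F (Φ ε z)) (noiseLaw n v) := fun ε =>
    (hΦ ε).integrable_comp_of_integrable hFi
  have hcard : (0 : ℝ) < Fintype.card (Fin p → Fin k → ℤˣ) := by
    exact_mod_cast Fintype.card_pos
  refine le_of_mul_le_mul_left ?_ hcard
  calc (Fintype.card (Fin p → Fin k → ℤˣ) : ℝ) * ∫ z, F z ∂noiseLaw n v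
      = ∑ ε, ∫ z, F (Φ ε z) ∂noiseLaw n v := by
        simp only [hinv, Finset.sum_const, Finset.card_univ, nsmul_eq_mul]
    _ = ∫ z, ∑ ε, F (Φ ε z) ∂noiseLaw n v := (integral_finsetSum _ fun ε _ => hint ε).symm
    _ ≤ ∫ _, Fintype.card (Fin p → Fin k → ℤˣ) * q ∂noiseLaw n v :=
        integral_mono_ae (integrable_finsetSum _ fun ε _ => hint ε) (integrable_const _) hpt
    _ = _ := by simp

/-- Jointly independent centred Gaussian entries have joint law `noiseLaw`. -/
lemma map_noise_eq {S : Type*} [MeasurableSpace S] {μ : Measure S}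
    {v : ℕ → ℝ≥0} {z : ∀ i, Fin (n i) → S → ℝ} (hz : ∀ i k, Measurable (z i k))
    (hz_law : ∀ i k, μ.map (z i k) = gaussianReal 0 (v i))
    (hz_indep : iIndepFun (fun (a : Σ i, Fin (n i)) => z a.1 a.2) μ) :
    μ.map (fun s i k => z i k s) = noiseLaw n v := by
  have h1 := hz_indep.map_fun_eq_infinitePi_map fun a : Σ i, Fin (n i) => hz a.1 a.2
  simp only [hz_law] at h1
  have h2 := Measure.infinitePi_map_piCurry (ι := ℕ) (κ := fun i => Fin (n i))
    (X := fun _ _ => ℝ) fun i _ => gaussianReal 0 (v i)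
  rw [← h1, Measure.map_map (by fun_prop) (by fun_prop)] at h2
  rw [noiseLaw]
  simp only [← Measure.infinitePi_eq_pi]
  exact h2

end Knockoff

theorem theorem1 {S : Type*} [MeasurableSpace S] (μ : Measure S) [IsProbabilityMeasure μ]
    (p : ℕ) (n : ℕ → ℕ)
    -- the designs, their knockoffs, the signals and the noise variances
    (X Xk : ∀ i, Matrix (Fin (n i)) (Fin p) ℝ)
    (hX : ∀ i, Knockoff.IsDesign (X i)) (hXk : ∀ i, Knockoff.IsKnockoff (X i) (Xk i))
    (β : ℕ → Fin p → ℝ) (v : ℕ → ℝ≥0)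
    -- the noise and the responses
    (z : ∀ i, Fin (n i) → S → ℝ) (hz : ∀ i k, Measurable (z i k))
    (hz_law : ∀ i k, μ.map (z i k) = gaussianReal 0 (v i))
    (hz_indep : iIndepFun (fun (a : Σ i, Fin (n i)) => z a.1 a.2) μ)
    (y : S → ∀ i, Fin (n i) → ℝ) (hy : ∀ s i, y s i = X i *ᵥ β i + fun k => z i k s)
    -- the possibly random number of models
    (m : S → ℕ) (hm : Measurable m) (hm_indep : IndepFun m (fun s i k => z i k s) μ)
    -- the knockoff statistics; almost surely no ties at true nulls
    (T : ℕ → Knockoff.Statistic p)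
    (hT : ∀ i j, β i j = 0 → ∀ᵐ s ∂μ, (T i).chi (X i) (Xk i) (y s i) j ≠ 0)
    -- the summary functions, the ranking rules, the confidence function and the level
    (Γ : ∀ k : ℕ, (Fin k → ℝ≥0) → ℝ≥0) (hΓ : ∀ k, Measurable (Γ k))
    (ρ : ℕ → (Fin p → ℝ≥0) → Equiv.Perm (Fin p)) (hρ : ∀ k, Knockoff.IsRankingRule (ρ k))
    (conf : ℝ → ℝ) (hconf : Knockoff.IsConfidence conf)
    (q : ℝ) (hq0 : 0 < q) (hq1 : q < 1) :
    Integrable (fun s => Knockoff.wFDP (Knockoff.IsNull β (m s))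
        (Knockoff.procedure (m s) X Xk T (Γ (m s)) (ρ (m s)) q conf (y s))) μ ∧
      ∫ s, Knockoff.wFDP (Knockoff.IsNull β (m s))
        (Knockoff.procedure (m s) X Xk T (Γ (m s)) (ρ (m s)) q conf (y s)) ∂μ ≤ q := by
  let F : ℕ × (∀ i, Fin (n i) → ℝ) → ℝ := fun x =>
    Knockoff.noiseFDP x.1 X Xk β T (Γ x.1) (ρ x.1) q conf x.2
  let ζ : S → ∀ i, Fin (n i) → ℝ := fun s i k => z i k s
  have hζ : Measurable ζ := by fun_prop
  have hζlaw : μ.map ζ = Knockoff.noiseLaw n v := Knockoff.map_noise_eq hz hz_law hz_indep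
  have hFm : Measurable F := by
    refine measurable_from_prod_countable_right fun k => ?_
    exact Knockoff.measurable_noiseFDP (k := k) (X := X) (Xk := Xk) (β := β) (T := T) (Γ := Γ k)
      (ρ := ρ k) (q := q) (conf := conf) (hΓ k) (hρ k)
  have hbound : ∀ x, ‖F x‖ ≤ 1 := fun x => by
    have h0 : 0 ≤ F x := Knockoff.noiseFDP_nonneg (k := x.1) (Γ := Γ x.1) (ρ := ρ x.1) hconf x.2
    have h1 : F x ≤ 1 := Knockoff.noiseFDP_le_one (k := x.1) (Γ := Γ x.1) (ρ := ρ x.1) hconf x.2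
    rwa [Real.norm_of_nonneg h0]
  have heq : (fun s => Knockoff.wFDP (Knockoff.IsNull β (m s))
      (Knockoff.procedure (m s) X Xk T (Γ (m s)) (ρ (m s)) q conf (y s))) =
      fun s => F (m s, ζ s) := by
    funext s
    have : y s = fun i => X i *ᵥ β i + ζ s i := funext (hy s)
    rw [this]
    rfl
  have hpair : Measurable fun s => (m s, ζ s) := hm.prodMk hζ
  rw [heq]
  refine ⟨.of_bound (hFm.comp hpair).aestronglyMeasurable 1 (.of_forall fun s => hbound _), ?_⟩
  have hT' : ∀ i j, β i j = 0 → ∀ᵐ x ∂Knockoff.noiseLaw n v,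
      (T i).chi (X i) (Xk i) (X i *ᵥ β i + x i) j ≠ 0 := by
    intro i j hij
    have hZ : Measurable fun x : ∀ i, Fin (n i) → ℝ =>
        (T i).Z (X i) (Xk i) (X i *ᵥ β i + x i) :=
      (T i).measurable_Z.comp (by fun_prop)
    have hset : MeasurableSet {x : ∀ i, Fin (n i) → ℝ |
        (T i).chi (X i) (Xk i) (X i *ᵥ β i + x i) j ≠ 0} := by
      simp only [Knockoff.Statistic.chi, ne_eq, Real.sign_eq_zero_iff, sub_eq_zero]
      exact (measurableSet_eq_fun ((measurable_pi_apply _).comp hZ)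
        ((measurable_pi_apply _).comp hZ)).compl
    rw [← hζlaw, ae_map_iff hζ.aemeasurable hset]
    filter_upwards [hT i j hij] with s hs
    rwa [hy s i] at hs
  have hlaw : μ.map (fun s => (m s, ζ s)) = (μ.map m).prod (Knockoff.noiseLaw n v) := by
    rw [← hζlaw]
    exact (indepFun_iff_map_prod_eq_prod_map_map hm.aemeasurable hζ.aemeasurable).1 hm_indep
  have hprob : IsProbabilityMeasure (μ.map m) := Measure.isProbabilityMeasure_map hm.aemeasurable
  have hFi : Integrable F ((μ.map m).prod (Knockoff.noiseLaw n v)) :=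
    .of_bound hFm.aestronglyMeasurable 1 (.of_forall hbound)
  calc ∫ s, F (m s, ζ s) ∂μ = ∫ x, F x ∂(μ.map m).prod (Knockoff.noiseLaw n v) := by
        rw [← hlaw, integral_map hpair.aemeasurable hFm.aestronglyMeasurable]
    _ = ∫ k, ∫ x, F (k, x) ∂Knockoff.noiseLaw n v ∂μ.map m := integral_prod _ hFi
    _ ≤ ∫ _, q ∂μ.map m := by
        refine integral_mono hFi.integral_prod_left (integrable_const _) fun k => ?_
        exact Knockoff.integral_noiseFDP_le (k := k) (Γ := Γ k) (ρ := ρ k) hXk v hT' (hΓ k) (hρ k)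
          hconf hq0
    _ = q := by simp
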